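/- Let $A\in\mathbb{R}^{n\times n}$ be symmetric with spectrum contained in $[0,1]$, let $\bm{w}\in\mathbb{R}^n$ with $\|\bm{w}\|_2=1$, let $m\ge 2$ be an integer and $0\le t\le 1$. Let $\psi$ be the entire function with $\psi(x^2)=2(1-\cos x)/x^2$, $\psi(0)=1$, and put $f(z;s)=\tfrac12 s^2\psi(s^2z)=\frac{1-\cos(s\sqrt z)}{z}$. Let $\bm{v}_1,\dots,\bm{v}_m$ be the Lanczos vectors of $A$ with starting vector $\bm{w}$: $\bm{v}_1=\bm{w}$, and $\bm{v}_{j+1}=\bm{p}_j/\|\bm{p}_j\|_2$ with $\bm{p}_j=A\bm{v}_j-(\bm{v}_j^TA\bm{v}_j)\bm{v}_j-(\bm{v}_{j-1}^TA\bm{v}_j)\bm{v}_{j-1}$ (without the last term for $j=1$); if the process breaks down, i.e. $\bm{p}_j=0$, then $\bm{v}_{j+1}$ and all later vectors are set to $0$. Let $V_m=[\bm{v}_1,\dots,\bm{v}_m]$ and $H_m=V_m^TAV_m$. Let $\bm{y}_m(s)=V_mf(H_m;s)V_m^T\bm{w}$ be the Lanczos approximation to $f(A;s)\bm{w}$, that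 is, to the solution of $\bm{y}''(s)=-A\bm{y}(s)+\bm{w}$, $\bm{y}(0)=\bm{y}'(0)=0$, and let $\bm{r}_m(s)=-A\bm{y}_m(s)+\bm{w}-\bm{y}_m''(s)$ be its residual. Then $$\|\bm{r}_m(t)\|_2\le\frac{128}{15}\cdot\frac{(t/2)^{2m}}{(2m)!}.$$ -/

import Mathlib

open scoped Matrix

namespace LanczosPsi

noncomputable section

/-- Taylor coefficients of the entire function `ψ` with `ψ(x²) = 2 (1 - cos x) / x²`. -/
def psiCoeff (k : ℕ) : ℝ := 2 * (-1) ^ k / ((2 * k + 2).factorial : ℝ)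

/-- The entire function `ψ(X) = ∑ 2 (-1)ᵏ Xᵏ / (2k+2)!`, on real numbers and on square matrices
alike. -/
def psi {R : Type*} [Ring R] [Algebra ℝ R] [TopologicalSpace R] (X : R) : R :=
  ∑' k : ℕ, psiCoeff k • X ^ k

/-- The function `f(X; t) = t²/2 ψ(t² X)`, i.e. `(1 - cos (t √X)) / X`. -/
def psiFun {R : Type*} [Ring R] [Algebra ℝ R] [TopologicalSpace R] (t : ℝ) (X : R) : R :=
  (t ^ 2 / 2) • psi (t ^ 2 • X)

variable {n : ℕ}

/-- The Lanczos vectors for `A` and the starting vector `w` (numbered from `0`): the first one is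
`w / ‖w‖`, and the next one is the normalization of `A v_j` minus its components along `v_j` and
`v_{j-1}` (three-term recurrence). If the process breaks down, that is, if the vector to be
normalized is `0`, then this and all later Lanczos vectors are `0`. -/
def lanczosVec (A : Matrix (Fin n) (Fin n) ℝ) (w : EuclideanSpace ℝ (Fin n)) :
    ℕ → EuclideanSpace ℝ (Fin n)
  | 0 => ‖w‖⁻¹ • w
  | 1 =>
    let v := lanczosVec A w 0
    let Av := Matrix.toEuclideanLin A v
    let p := Av - inner ℝ v Av • v
    ‖p‖⁻¹ • p
  | j + 2 =>
    let v' := lanczosVec A w j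
    let v := lanczosVec A w (j + 1)
    let Av := Matrix.toEuclideanLin A v
    let p := Av - inner ℝ v Av • v - inner ℝ v' Av • v'
    ‖p‖⁻¹ • p

/-- The matrix `V_m` whose columns are the first `m` Lanczos vectors. -/
def lanczosV (A : Matrix (Fin n) (Fin n) ℝ) (w : EuclideanSpace ℝ (Fin n)) (m : ℕ) :
    Matrix (Fin n) (Fin m) ℝ :=
  Matrix.of fun i j => lanczosVec A w j i

/-- The projected matrix `H_m = V_mᵀ A V_m`. -/
def lanczosH (A : Matrix (Fin n) (Fin n) ℝ) (w : EuclideanSpace ℝ (Fin n)) (m : ℕ) :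
    Matrix (Fin m) (Fin m) ℝ :=
  (lanczosV A w m)ᵀ * A * lanczosV A w m

/-- The Lanczos approximation `y_m(t) = V_m f(H_m; t) V_mᵀ w` to `f(A; t) w`. -/
def lanczosApprox (A : Matrix (Fin n) (Fin n) ℝ) (w : EuclideanSpace ℝ (Fin n)) (m : ℕ)
    (t : ℝ) : EuclideanSpace ℝ (Fin n) :=
  Matrix.toEuclideanLin
    (lanczosV A w m * psiFun t (lanczosH A w m) * (lanczosV A w m)ᵀ) w

/-- The residual `r_m(t) = -A y_m(t) + w - y_m''(t)` of the Lanczos approximation with respect to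
the initial value problem `y'' = -A y + w`, `y(0) = y'(0) = 0`, solved by `f(A; t) w`. -/
def lanczosResidual (A : Matrix (Fin n) (Fin n) ℝ) (w : EuclideanSpace ℝ (Fin n)) (m : ℕ)
    (t : ℝ) : EuclideanSpace ℝ (Fin n) :=
  -Matrix.toEuclideanLin A (lanczosApprox A w m t) + w - iteratedDeriv 2 (lanczosApprox A w m) t

theorem psi_zero : psi (0 : ℝ) = 1 := by
  unfold psi
  rw [tsum_eq_single 0]
  · simp [psiCoeff]
  · intro k hk
    simp [hk]

theorem psi_sq (x : ℝ) (hx : x ≠ 0) : psi (x ^ 2) = 2 * (1 - Real.cos x) / x ^ 2 := by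
  have h := Real.hasSum_cos x
  have h1 := (hasSum_nat_add_iff' 1).mpr h
  have h2 := h1.mul_left (-2 / x ^ 2)
  unfold psi
  have e1 : ∀ k : ℕ, psiCoeff k • (x ^ 2) ^ k
      = -2 / x ^ 2 * ((-1) ^ (k + 1) * x ^ (2 * (k + 1)) / ((2 * (k + 1)).factorial : ℝ)) := by
    intro k
    have e : 2 * (k + 1) = 2 * k + 2 := by ring
    simp only [psiCoeff, smul_eq_mul, e]
    field_simp
    ring
  have e2 : -2 / x ^ 2 * (Real.cos x - 1) = 2 * (1 - Real.cos x) / x ^ 2 := by ring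
  rw [tsum_congr e1, h2.tsum_eq]
  simpa using e2

theorem hasFPowerSeriesOnBall_psi {R : Type*} [NormedRing R] [NormedAlgebra ℝ R]
    [CompleteSpace R] :
    HasFPowerSeriesOnBall (psi : R → R) (FormalMultilinearSeries.ofScalars R psiCoeff) 0 ⊤ := by
  have hr : (FormalMultilinearSeries.ofScalars R psiCoeff).radius = ⊤ := by
    apply FormalMultilinearSeries.ofScalars_radius_eq_top_of_tendsto
    · refine Filter.Eventually.of_forall fun k => ?_
      unfold psiCoeff
      positivity
    · have key : ∀ k : ℕ, ‖psiCoeff k.succ‖ / ‖psiCoeff k‖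
          = 1 / ((2 * (k : ℝ) + 3) * (2 * k + 4)) := by
        intro k
        have e : 2 * k.succ + 2 = (2 * k + 2 + 1) + 1 := by simp only [Nat.succ_eq_add_one]; ring
        simp only [psiCoeff, e, Nat.factorial_succ (2 * k + 2 + 1), Nat.factorial_succ (2 * k + 2),
          norm_div, norm_mul, norm_pow, norm_neg, norm_one, one_pow, Nat.cast_mul, RCLike.norm_natCast]
        have : ((2 * k + 2).factorial : ℝ) ≠ 0 := by positivity
        push_cast
        field_simp
        ring
      simp only [key]
      refine squeeze_zero (fun k => by positivity) (fun k => ?_)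
        tendsto_one_div_add_atTop_nhds_zero_nat
      apply one_div_le_one_div_of_le (by positivity)
      nlinarith [(Nat.cast_nonneg k : (0 : ℝ) ≤ k)]
  have h := (FormalMultilinearSeries.ofScalars R psiCoeff).hasFPowerSeriesOnBall (by simp [hr])
  rw [hr] at h
  have e : (FormalMultilinearSeries.ofScalars R psiCoeff).sum = psi := by
    funext X
    exact FormalMultilinearSeries.ofScalars_sum_eq psiCoeff X
  rwa [e] at h

/-- The power series of `ψ` converges for every square matrix. -/
theorem hasSum_psi_matrix {m : ℕ} (X : Matrix (Fin m) (Fin m) ℝ) :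
    HasSum (fun k => psiCoeff k • X ^ k) (psi X) := by
  let _ : NormedRing (Matrix (Fin m) (Fin m) ℝ) := Matrix.linftyOpNormedRing
  let _ : NormedAlgebra ℝ (Matrix (Fin m) (Fin m) ℝ) := Matrix.linftyOpNormedAlgebra
  have h := (hasFPowerSeriesOnBall_psi (R := Matrix (Fin m) (Fin m) ℝ)).hasSum (y := X) (by simp)
  simp only [FormalMultilinearSeries.ofScalars_apply_eq, zero_add] at h
  exact h

/-- The Lanczos approximation depends smoothly on `t`. -/
theorem contDiff_lanczosApprox (A : Matrix (Fin n) (Fin n) ℝ) (w : EuclideanSpace ℝ (Fin n))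
    (m : ℕ) : ContDiff ℝ (⊤ : ℕ∞) (lanczosApprox A w m) := by
  let _ : NormedRing (Matrix (Fin m) (Fin m) ℝ) := Matrix.linftyOpNormedRing
  let _ : NormedAlgebra ℝ (Matrix (Fin m) (Fin m) ℝ) := Matrix.linftyOpNormedAlgebra
  have h1 : ContDiff ℝ (⊤ : ℕ∞) (psi : Matrix (Fin m) (Fin m) ℝ → Matrix (Fin m) (Fin m) ℝ) := by
    rw [contDiff_iff_contDiffAt]
    intro X
    exact ((hasFPowerSeriesOnBall_psi.analyticAt_of_mem (by simp)).contDiffAt)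
  have h2 : ContDiff ℝ (⊤ : ℕ∞) fun t => psiFun t (lanczosH A w m) := by
    unfold psiFun
    have h3 : ContDiff ℝ (⊤ : ℕ∞) fun t : ℝ => t ^ 2 • lanczosH A w m := by fun_prop
    have h4 : ContDiff ℝ (⊤ : ℕ∞) fun t : ℝ => t ^ 2 / 2 := by fun_prop
    exact h4.smul (h1.comp h3)
  let L : Matrix (Fin m) (Fin m) ℝ →ₗ[ℝ] EuclideanSpace ℝ (Fin n) :=
    { toFun := fun F => Matrix.toEuclideanLin (lanczosV A w m * F * (lanczosV A w m)ᵀ) w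
      map_add' := fun F G => by simp [Matrix.mul_add, Matrix.add_mul]
      map_smul' := fun c F => by simp }
  exact (LinearMap.toContinuousLinearMap L).contDiff.comp h2

end

end LanczosPsi

namespace LanczosPsi

noncomputable section

open Polynomial Finset

/-! Let `P = V_m V_mᵀ`, the orthogonal projection onto the span of the Lanczos vectors, `G = P A P`
and `R = (1 - P) A`. The approximation `y_m` is the power series of `f(G; t) w`, so `y_m'' = -G y_m
+ w`; since `P y_m = y_m`, the residual is `-R y_m`. Orthogonality of the Lanczos vectors makes `G`
act like `A` on the low Krylov vectors, whence `R Gʲ w = 0` for `j < N := m - 1`.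

The remaining terms `R Gᵏ w` are not estimated by 1. With `B = 2G - 1`, the expansion `4ᵏ Gᵏ = (2 +
2B)ᵏ = ∑ C(2k,i) T_{k-i}(B)` (`two_add_two_X_pow_mul_T`) loses all its terms with `|k - i| < N`
under `R`. The others are contractions, so two binomial tails survive (`norm_apply_pow_le`). Against
`(2k+2)!` these tails grow slowly enough (`four_pow_mul_sum_choose_le`) that the series is dominated
by a geometric one of ratio `1/16`, whose sum gives `128/15 = 8 · 16/15`. -/

/-! ### Binomial tails against factorials -/

theorem sum_choose_add_two_le (n s : ℕ) (hs : 1 ≤ s) (hsn : s ≤ n + 1) :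
    ∑ i ∈ range (s + 1), (n + 2).choose i ≤ (n + 4) * ∑ i ∈ range s, n.choose i := by
  induction s, hs using Nat.le_induction with
  | base => simp [sum_range_succ]; omega
  | succ s hs ih =>
    rw [sum_range_succ, sum_range_succ (fun i => n.choose i) s, mul_add]
    -- Termwise comparison: `C(n+2,s+1) = (n+2)(n+1) / ((s+1)(n+1-s)) · C(n,s)`, and `(s+1)(n+1-s) ≥
    -- n+1`. The unmatched term `C(n+2,0)` was absorbed in the base case.
    refine Nat.add_le_add (ih (by omega)) ?_
    obtain ⟨d, rfl⟩ : ∃ d, n = s + d := ⟨n - s, by omega⟩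
    have h1 := Nat.add_one_mul_choose_eq (s + d + 1) s
    have h2 := Nat.choose_mul_succ_eq (s + d) s
    have e : s + d + 1 - s = d + 1 := by omega
    rw [e] at h2
    have h3 : (s + d + 2).choose (s + 1) * ((s + 1) * (d + 1))
        = (s + d + 2) * (s + d + 1) * (s + d).choose s := by
      have h1' : (s + d + 2) * (s + d + 1).choose s = (s + d + 2).choose (s + 1) * (s + 1) := h1
      calc _ = (s + d + 2).choose (s + 1) * (s + 1) * (d + 1) := by ring
        _ = (s + d + 2) * ((s + d + 1).choose s * (d + 1)) := by rw [← h1']; ring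
        _ = _ := by rw [← h2]; ring
    have h4 : s + d + 1 ≤ (s + 1) * (d + 1) := by nlinarith [Nat.zero_le (s * d)]
    refine Nat.le_of_mul_le_mul_right (c := s + d + 1) ?_ (by omega)
    calc _ ≤ (s + d + 2).choose (s + 1) * ((s + 1) * (d + 1)) := Nat.mul_le_mul_left _ h4
      _ = (s + d + 2) * (s + d + 1) * (s + d).choose s := h3
      _ ≤ (s + d + 4) * (s + d + 1) * (s + d).choose s := by gcongr; omega
      _ = _ := by ring

theorem four_pow_mul_sum_choose_le (N j : ℕ) (hN : 1 ≤ N) :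
    4 ^ j * (∑ i ∈ range (j + 1), (2 * (N + j)).choose i) * (2 * N + 2).factorial
      ≤ (2 * (N + j) + 2).factorial := by
  induction j with
  | zero => simp
  | succ j ih =>
    have h := sum_choose_add_two_le (2 * (N + j)) (j + 1) (by omega) (by omega)
    have e : 2 * (N + (j + 1)) = 2 * (N + j) + 2 := by ring
    rw [e, Nat.factorial_succ (2 * (N + j) + 2 + 1), Nat.factorial_succ (2 * (N + j) + 2)]
    set D := ∑ i ∈ range (j + 1), (2 * (N + j)).choose i
    calc _ ≤ 4 ^ (j + 1) * ((2 * (N + j) + 4) * D) * (2 * N + 2).factorial := by gcongr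
      _ = 4 * (2 * (N + j) + 4) * (4 ^ j * D * (2 * N + 2).factorial) := by ring
      _ ≤ 4 * (2 * (N + j) + 4) * (2 * (N + j) + 2).factorial := by gcongr
      -- Needs `4 ≤ 2(N+j) + 3`, which is where `N ≥ 1`, that is `m ≥ 2`, enters.
      _ ≤ (2 * (N + j) + 3) * (2 * (N + j) + 4) * (2 * (N + j) + 2).factorial := by
        gcongr; omega
      _ = _ := by ring

/-! ### Chebyshev identities -/

/-- With `X = cos θ`, `2 + 2X = (e^{iθ/2} + e^{-iθ/2})²`, so this is the binomial theorem with
exponent `2k`. A general index `j` lets the induction close: one factor is a second-order shift,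
matched by Pascal's rule used twice. -/
theorem two_add_two_X_pow_mul_T (k : ℕ) (j : ℤ) :
    (2 + 2 * X) ^ k * Chebyshev.T ℝ j
      = ∑ i ∈ range (2 * k + 1), (2 * k).choose i • Chebyshev.T ℝ (j + k - i) := by
  induction k generalizing j with
  | zero => simp
  | succ k ih =>
    have e1 : (2 + 2 * X) * Chebyshev.T ℝ j
        = Chebyshev.T ℝ (j + 1) + 2 * Chebyshev.T ℝ j + Chebyshev.T ℝ (j - 1) := by
      rw [Chebyshev.T_add_one]; ring
    have pascal := fun (f : ℕ → ℝ[X]) n => sum_choose_succ_nsmul (fun i _ => f i) n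
    rw [pow_succ, mul_assoc, e1, mul_add, mul_add, mul_left_comm, ih, ih, ih,
      show 2 * (k + 1) = 2 * k + 1 + 1 by ring, pascal, pascal, pascal]
    have s1 : ∀ i : ℕ, j + 1 + k - i = j + (k + 1 : ℕ) - i := fun i => by push_cast; ring
    have s2 : ∀ i : ℕ, j + k - i = j + (k + 1 : ℕ) - (i + 1 : ℕ) := fun i => by push_cast; ring
    have s3 : ∀ i : ℕ, j - 1 + k - i = j + (k + 1 : ℕ) - (i + 1 + 1 : ℕ) :=
      fun i => by push_cast; ring
    simp only [s1, s2, s3]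
    ring

/-- The polynomial form of `cos² + sin² = 1`; it bounds `T_j(B)` without diagonalizing `B`. -/
theorem T_sq_add_mul_U_sq (j : ℕ) :
    Chebyshev.T ℝ (j : ℤ) ^ 2 + (1 - X ^ 2) * Chebyshev.U ℝ ((j : ℤ) - 1) ^ 2 = 1 := by
  induction j with
  | zero => simp
  | succ j ih =>
    have h1 := Chebyshev.T_eq_X_mul_T_sub_pol_U ℝ ((j : ℤ) - 1)
    have h2 := Chebyshev.U_eq_X_mul_U_add_T ℝ ((j : ℤ) - 1)
    rw [show (j : ℤ) - 1 + 2 = j + 1 by ring, show (j : ℤ) - 1 + 1 = j by ring] at h1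
    rw [show (j : ℤ) - 1 + 1 = j by ring] at h2
    rw [show ((j + 1 : ℕ) : ℤ) = j + 1 by push_cast; ring, show (j : ℤ) + 1 - 1 = j by ring,
      h1, h2]
    linear_combination ih

/-! ### Chebyshev polynomials of a symmetric contraction -/

section Operators

variable {E : Type*} [NormedAddCommGroup E] [InnerProductSpace ℝ E]

theorem isSymmetric_aeval {B : E →ₗ[ℝ] E} (hB : B.IsSymmetric) (p : ℝ[X]) :
    (aeval B p).IsSymmetric := by
  induction p using Polynomial.induction_on' with
  | add p q hp hq => rw [map_add]; exact hp.add hq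
  | monomial k c =>
    rw [aeval_monomial, ← Algebra.smul_def]
    exact (hB.pow k).smul (by simp)

/-- Pairing the Pell identity with `x` gives `‖T x‖² + ‖U x‖² - ‖B U x‖² = ‖x‖²`, and `B` is a
contraction. -/
theorem norm_aeval_T_le {B : E →ₗ[ℝ] E} (hB : B.IsSymmetric) (hB1 : ∀ x, ‖B x‖ ≤ ‖x‖)
    (j : ℤ) (x : E) : ‖aeval B (Chebyshev.T ℝ j) x‖ ≤ ‖x‖ := by
  rw [← Chebyshev.T_natAbs]
  set k := j.natAbs
  set T := aeval B (Chebyshev.T ℝ (k : ℤ)) with hT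
  set U := aeval B (Chebyshev.U ℝ ((k : ℤ) - 1)) with hU
  have hTs : T.IsSymmetric := isSymmetric_aeval hB _
  have hUs : U.IsSymmetric := isSymmetric_aeval hB _
  have hBUs : (aeval B (X * Chebyshev.U ℝ ((k : ℤ) - 1))).IsSymmetric := isSymmetric_aeval hB _
  have h := congrArg (fun p => inner ℝ (aeval B p x) x) (T_sq_add_mul_U_sq k)
  have e : Chebyshev.T ℝ (k : ℤ) ^ 2 + (1 - X ^ 2) * Chebyshev.U ℝ ((k : ℤ) - 1) ^ 2
      = Chebyshev.T ℝ (k : ℤ) * Chebyshev.T ℝ (k : ℤ)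
        + Chebyshev.U ℝ ((k : ℤ) - 1) * Chebyshev.U ℝ ((k : ℤ) - 1)
        - (X * Chebyshev.U ℝ ((k : ℤ) - 1)) * (X * Chebyshev.U ℝ ((k : ℤ) - 1)) := by ring
  simp only [e] at h
  rw [map_sub, map_add, map_mul, map_mul, map_mul (aeval B) (X * _), ← hT, ← hU, map_one,
    LinearMap.sub_apply, LinearMap.add_apply, inner_sub_left, inner_add_left,
    Module.End.mul_apply, Module.End.mul_apply, Module.End.mul_apply, hTs, hUs, hBUs,
    real_inner_self_eq_norm_sq, real_inner_self_eq_norm_sq, real_inner_self_eq_norm_sq,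
    Module.End.one_apply, real_inner_self_eq_norm_sq, map_mul, aeval_X, ← hU,
    Module.End.mul_apply] at h
  have h1 := hB1 (U x)
  have h2 : ‖B (U x)‖ ^ 2 ≤ ‖U x‖ ^ 2 := by gcongr
  exact le_of_sq_le_sq (by linarith) (norm_nonneg _)

/-- The hypothesis `G² ≤ G` encodes spectrum in `[0,1]`, which `2G - 1` moves to `[-1,1]`. -/
theorem norm_two_smul_sub_le {G : E →ₗ[ℝ] E} (hG : ∀ x, ‖G x‖ ^ 2 ≤ inner ℝ (G x) x) (x : E) :
    ‖(2 • G - 1 : E →ₗ[ℝ] E) x‖ ≤ ‖x‖ := by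
  have h : ‖(2 • G - 1 : E →ₗ[ℝ] E) x‖ ^ 2 = 4 * ‖G x‖ ^ 2 - 4 * inner ℝ (G x) x + ‖x‖ ^ 2 := by
    rw [LinearMap.sub_apply, LinearMap.smul_apply, norm_sub_sq_real, Module.End.one_apply,
      two_nsmul, inner_add_left, ← two_smul ℝ, norm_smul, Real.norm_ofNat]
    ring
  exact le_of_sq_le_sq (by linarith [hG x]) (norm_nonneg _)

/-- If the linear map `R` annihilates the Krylov vectors `Gʲ w` with `j < N`, then the expansion
of `xᵏ` in shifted Chebyshev polynomials bounds `R (Gᵏ w)`. -/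
theorem norm_apply_pow_le {G R : E →ₗ[ℝ] E} (hGs : G.IsSymmetric)
    (hG : ∀ x, ‖G x‖ ^ 2 ≤ inner ℝ (G x) x) (hR : ∀ x, ‖R x‖ ≤ ‖x‖) {w : E} (hw : ‖w‖ = 1)
    {N : ℕ} (hRG : ∀ j < N, R ((G ^ j) w) = 0) (k : ℕ) :
    ‖R ((G ^ k) w)‖ ≤ 2 / 4 ^ k * ∑ i ∈ range (k + 1 - N), ((2 * k).choose i : ℝ) := by
  set B : E →ₗ[ℝ] E := 2 • G - 1 with hB
  have hBs : B.IsSymmetric := by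
    rw [hB, two_nsmul]
    exact (hGs.add hGs).sub LinearMap.IsSymmetric.one
  have hlow : ∀ p : ℝ[X], p.natDegree < N → R (aeval B p w) = 0 := by
    intro p hp
    have e : B = aeval G (2 * X - 1 : ℝ[X]) := by simp [hB, two_mul]
    rw [e, ← aeval_comp, aeval_eq_sum_range, LinearMap.sum_apply, map_sum]
    refine sum_eq_zero fun i hi => ?_
    have hd : (p.comp (2 * X - 1)).natDegree ≤ p.natDegree := by
      refine natDegree_comp_le.trans ?_
      have : (2 * X - 1 : ℝ[X]).natDegree ≤ 1 := by compute_degree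
      nlinarith
    rw [LinearMap.smul_apply, map_smul, hRG i (by have := mem_range.1 hi; omega), smul_zero]
  have hT : ∀ j : ℤ, ‖R (aeval B (Chebyshev.T ℝ j) w)‖ ≤ if j.natAbs < N then 0 else 1 := by
    intro j
    split_ifs with h
    · rw [hlow _ (by rwa [Chebyshev.natDegree_T]), norm_zero]
    · exact (hR _).trans ((norm_aeval_T_le hBs (norm_two_smul_sub_le hG) j w).trans hw.le)
  have hexp := congrArg (fun p => R (aeval B p w)) (two_add_two_X_pow_mul_T k 0)
  have e4 : aeval B (2 + 2 * X : ℝ[X]) = (4 : ℝ) • G := by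
    rw [map_add, map_mul, aeval_X, map_ofNat, hB]
    ext x
    simp only [LinearMap.add_apply, Module.End.mul_apply, LinearMap.sub_apply,
      LinearMap.smul_apply, Module.End.ofNat_apply, Module.End.one_apply]
    module
  simp only [Chebyshev.T_zero, mul_one, map_pow, e4, _root_.smul_pow, LinearMap.smul_apply, map_smul,
    map_sum, map_nsmul, LinearMap.sum_apply] at hexp
  have hn := congrArg norm hexp
  rw [norm_smul] at hn
  have hs : ∑ i ∈ range (2 * k + 1), (if i < k + 1 - N then ((2 * k).choose i : ℝ) else 0)
      ≤ ∑ i ∈ range (k + 1 - N), ((2 * k).choose i : ℝ) := by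
    rw [← sum_filter]
    refine sum_le_sum_of_subset_of_nonneg (fun i hi => ?_) fun _ _ _ => by positivity
    exact mem_range.2 (mem_filter.1 hi).2
  have hs' : ∑ i ∈ range (2 * k + 1), (if 2 * k - i < k + 1 - N then ((2 * k).choose i : ℝ) else 0)
      = ∑ i ∈ range (2 * k + 1), (if i < k + 1 - N then ((2 * k).choose i : ℝ) else 0) := by
    rw [← sum_range_reflect]
    refine sum_congr rfl fun i hi => ?_
    have hi : i ≤ 2 * k := by have := mem_range.1 hi; omega
    rw [show 2 * k + 1 - 1 - i = 2 * k - i by omega, Nat.choose_symm hi,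
      show 2 * k - (2 * k - i) = i by omega]
  have hb : (4 : ℝ) ^ k * ‖R ((G ^ k) w)‖
      ≤ 2 * ∑ i ∈ range (k + 1 - N), ((2 * k).choose i : ℝ) := by
    have h4 : ‖(4 : ℝ) ^ k‖ = 4 ^ k := by simp
    rw [← h4, hn]
    calc _ ≤ ∑ i ∈ range (2 * k + 1), ((if i < k + 1 - N then ((2 * k).choose i : ℝ) else 0)
          + (if 2 * k - i < k + 1 - N then ((2 * k).choose i : ℝ) else 0)) := by
          refine norm_sum_le_of_le _ fun i hi => ?_
          have hi := mem_range.1 hi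
          have h1 : ‖(2 * k).choose i • R (aeval B (Chebyshev.T ℝ (0 + k - i)) w)‖
              ≤ (2 * k).choose i * (if (0 + k - i : ℤ).natAbs < N then 0 else 1) := by
            rw [← Nat.cast_smul_eq_nsmul ℝ, norm_smul, RCLike.norm_natCast]
            gcongr
            exact hT _
          refine h1.trans ?_
          have hc : (0 : ℝ) ≤ (2 * k).choose i := by positivity
          -- `|k - i| ≥ N` puts `i` in one of the two tails. If `k < N`, the truncated `k + 1 - N`
          -- is `0` and no index survives.
          split_ifs <;> first | omega | simp
      _ ≤ _ := by rw [sum_add_distrib, hs']; linarith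
  rw [div_mul_eq_mul_div, le_div_iff₀ (by positivity)]
  linarith

end Operators

/-! ### Differentiating exponential-type series -/

section Series

variable {E : Type*} [NormedAddCommGroup E] [NormedSpace ℝ E] [CompleteSpace E]

theorem summable_pow_div_factorial_smul {b : ℕ → E} {c : ℝ} (hb : ∀ k, ‖b k‖ ≤ c) (t : ℝ) :
    Summable fun k => (t ^ k / (k.factorial : ℝ)) • b k := by
  refine .of_norm_bounded ((Real.summable_pow_div_factorial |t|).mul_right c) fun k => ?_
  rw [norm_smul, norm_div, norm_pow, Real.norm_eq_abs, RCLike.norm_natCast]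
  gcongr
  exact hb k

/-- Termwise differentiation, dominated on the ball of radius `|t| + 1`, merely shifts the
coefficients. -/
theorem hasDerivAt_tsum_pow_div_factorial_smul {b : ℕ → E} {c : ℝ} (hb : ∀ k, ‖b k‖ ≤ c)
    (t : ℝ) :
    HasDerivAt (fun s : ℝ => ∑' k : ℕ, (s ^ k / (k.factorial : ℝ)) • b k)
      (∑' k : ℕ, (t ^ k / (k.factorial : ℝ)) • b (k + 1)) t := by
  set g' : ℕ → ℝ → E := fun k s => (k * s ^ (k - 1) / (k.factorial : ℝ)) • b k with hg'
  have hg's : ∀ k s, g' (k + 1) s = (s ^ k / (k.factorial : ℝ)) • b (k + 1) := by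
    intro k s
    simp only [hg', Nat.factorial_succ, add_tsub_cancel_right]
    push_cast
    congr 1
    field_simp
  set r := |t| + 1
  set u : ℕ → ℝ := fun k => k * r ^ (k - 1) / (k.factorial : ℝ) * c with hu'
  have hu : Summable u := by
    rw [← summable_nat_add_iff 1]
    convert! (Real.summable_pow_div_factorial r).mul_right c using 2 with k
    simp only [hu', Nat.factorial_succ, add_tsub_cancel_right]
    push_cast
    field_simp
  have hr : 0 < r := by positivity
  have ht : t ∈ Metric.ball (0 : ℝ) r := by simp [r]
  have h := hasDerivAt_tsum_of_isPreconnected (g := fun k (s : ℝ) => (s ^ k / (k.factorial : ℝ)) • b k)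
    (g' := g') hu Metric.isOpen_ball (convex_ball (0 : ℝ) r).isPreconnected
    (fun k s _ => ((hasDerivAt_pow k s).div_const _).smul_const _)
    (fun k s hs => ?_) ht (summable_pow_div_factorial_smul hb t) ht
  · have hsum : Summable fun k => g' k t := by
      rw [← summable_nat_add_iff 1]
      simp only [hg's]
      exact summable_pow_div_factorial_smul (fun k => hb (k + 1)) t
    rw [hsum.tsum_eq_zero_add] at h
    simp only [hg's] at h
    simpa [hg'] using h
  · have hs : |s| ≤ r := by simpa using (Metric.mem_ball.1 hs).le
    simp only [hg', hu', norm_smul, norm_div, norm_mul, norm_pow, RCLike.norm_natCast,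
      Real.norm_eq_abs]
    gcongr
    exact hb k

theorem iteratedDeriv_two_tsum {b : ℕ → E} {c : ℝ} (hb : ∀ k, ‖b k‖ ≤ c) (t : ℝ) :
    iteratedDeriv 2 (fun s : ℝ => ∑' k : ℕ, (s ^ k / (k.factorial : ℝ)) • b k) t
      = ∑' k : ℕ, (t ^ k / (k.factorial : ℝ)) • b (k + 2) := by
  have h1 : deriv (fun s : ℝ => ∑' k : ℕ, (s ^ k / (k.factorial : ℝ)) • b k)
      = fun s : ℝ => ∑' k : ℕ, (s ^ k / (k.factorial : ℝ)) • b (k + 1) :=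
    funext fun s => (hasDerivAt_tsum_pow_div_factorial_smul hb s).deriv
  rw [iteratedDeriv_succ, iteratedDeriv_one, h1]
  exact (hasDerivAt_tsum_pow_div_factorial_smul (fun k => hb (k + 1)) t).deriv

end Series

/-! ### From the spectrum to quadratic forms -/

theorem inner_toEuclideanLin_bounds {n : ℕ} {A : Matrix (Fin n) (Fin n) ℝ} (hA : A.IsSymm)
    (hspec : spectrum ℝ A ⊆ Set.Icc 0 1) (x : EuclideanSpace ℝ (Fin n)) :
    0 ≤ inner ℝ (Matrix.toEuclideanLin A x) x ∧
      inner ℝ (Matrix.toEuclideanLin A x) x ≤ inner ℝ x x := by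
  have hH : A.IsHermitian := by
    rw [Matrix.IsHermitian, Matrix.conjTranspose_eq_transpose_of_trivial]; exact hA
  have h0 : A.PosSemidef :=
    Matrix.posSemidef_iff_isHermitian_and_spectrum_nonneg.2 ⟨hH, fun c hc => (hspec hc).1⟩
  have h1 : (1 - A).PosSemidef := by
    refine Matrix.posSemidef_iff_isHermitian_and_spectrum_nonneg.2
      ⟨Matrix.isHermitian_one.sub hH, fun c hc => ?_⟩
    have e : (1 - A) = algebraMap ℝ _ 1 - A := by simp
    rw [e, ← spectrum.singleton_sub_eq] at hc
    obtain ⟨d, hd, rfl⟩ : ∃ d ∈ spectrum ℝ A, 1 - d = c := by simpa using hc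
    exact sub_nonneg.2 (hspec hd).2
  rw [← Matrix.isPositive_toEuclideanLin_iff] at h0 h1
  refine ⟨h0.2 x, ?_⟩
  have := h1.2 x
  rw [map_sub, Matrix.toLpLin_one, LinearMap.sub_apply, inner_sub_left] at this
  simpa using this

/-- `a - a² = (1 - a) a (1 - a) + a (1 - a) a`, a sum of two nonnegative forms. -/
theorem norm_sq_apply_le_inner {E : Type*} [NormedAddCommGroup E] [InnerProductSpace ℝ E]
    {a : E →ₗ[ℝ] E} (ha : a.IsSymmetric)
    (h : ∀ x, 0 ≤ inner ℝ (a x) x ∧ inner ℝ (a x) x ≤ inner ℝ x x) (x : E) :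
    ‖a x‖ ^ 2 ≤ inner ℝ (a x) x := by
  have h1 := (h (x - a x)).1
  have h2 := (h (a x)).2
  rw [map_sub, inner_sub_left, inner_sub_right, inner_sub_right, ha (a x) x] at h1
  rw [← real_inner_self_eq_norm_sq]
  linarith

/-! ### Lanczos vectors and their spans -/

section Lanczos

variable {n : ℕ} (A : Matrix (Fin n) (Fin n) ℝ) (w : EuclideanSpace ℝ (Fin n))

/-- The span of the first `j + 1` Lanczos vectors. -/
def lanczosSpan (j : ℕ) : Submodule ℝ (EuclideanSpace ℝ (Fin n)) :=
  Submodule.span ℝ (lanczosVec A w '' Set.Iic j)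

theorem lanczosVec_mem_lanczosSpan {i j : ℕ} (h : i ≤ j) :
    lanczosVec A w i ∈ lanczosSpan A w j :=
  Submodule.subset_span ⟨i, h, rfl⟩

theorem mem_lanczosSpan_zero (hw : ‖w‖ = 1) : w ∈ lanczosSpan A w 0 := by
  have e : lanczosVec A w 0 = w := by rw [lanczosVec, hw, inv_one, one_smul]
  have h := lanczosVec_mem_lanczosSpan A w (le_refl 0)
  rwa [e] at h

theorem norm_smul_norm_inv_smul {E : Type*} [NormedAddCommGroup E] [NormedSpace ℝ E] (p : E) :
    ‖p‖ • ‖p‖⁻¹ • p = p := by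
  rcases eq_or_ne p 0 with rfl | h
  · simp
  · rw [smul_inv_smul₀ (norm_ne_zero_iff.2 h)]

theorem toEuclideanLin_lanczosVec_mem (j : ℕ) :
    Matrix.toEuclideanLin A (lanczosVec A w j) ∈ lanczosSpan A w (j + 1) := by
  rcases j with _ | j
  · set v := lanczosVec A w 0 with hv
    set p := Matrix.toEuclideanLin A v - inner ℝ v (Matrix.toEuclideanLin A v) • v with hp
    have e1 : lanczosVec A w 1 = ‖p‖⁻¹ • p := by rw [lanczosVec]
    have e : Matrix.toEuclideanLin A v
        = ‖p‖ • lanczosVec A w 1 + inner ℝ v (Matrix.toEuclideanLin A v) • v := by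
      rw [e1, norm_smul_norm_inv_smul, hp, sub_add_cancel]
    rw [e]
    exact add_mem (Submodule.smul_mem _ _ (lanczosVec_mem_lanczosSpan A w le_rfl))
      (Submodule.smul_mem _ _ (lanczosVec_mem_lanczosSpan A w (Nat.zero_le _)))
  · set v' := lanczosVec A w j with hv'
    set v := lanczosVec A w (j + 1) with hv
    set p := Matrix.toEuclideanLin A v - inner ℝ v (Matrix.toEuclideanLin A v) • v
      - inner ℝ v' (Matrix.toEuclideanLin A v) • v' with hp
    have e1 : lanczosVec A w (j + 2) = ‖p‖⁻¹ • p := by rw [lanczosVec]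
    have e : Matrix.toEuclideanLin A v
        = ‖p‖ • lanczosVec A w (j + 2) + inner ℝ v' (Matrix.toEuclideanLin A v) • v'
          + inner ℝ v (Matrix.toEuclideanLin A v) • v := by
      rw [e1, norm_smul_norm_inv_smul, hp, sub_add_cancel, sub_add_cancel]
    rw [e]
    exact add_mem (add_mem
      (Submodule.smul_mem _ _ (lanczosVec_mem_lanczosSpan A w le_rfl))
      (Submodule.smul_mem _ _ (lanczosVec_mem_lanczosSpan A w (by omega))))
      (Submodule.smul_mem _ _ (lanczosVec_mem_lanczosSpan A w (by omega)))

theorem toEuclideanLin_mem_lanczosSpan_succ {j : ℕ} {x : EuclideanSpace ℝ (Fin n)}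
    (hx : x ∈ lanczosSpan A w j) : Matrix.toEuclideanLin A x ∈ lanczosSpan A w (j + 1) := by
  have h : lanczosSpan A w j ≤ (lanczosSpan A w (j + 1)).comap (Matrix.toEuclideanLin A) := by
    refine Submodule.span_le.2 ?_
    rintro _ ⟨i, hi, rfl⟩
    exact Submodule.span_mono (Set.image_mono (Set.Iic_subset_Iic.2 (Nat.succ_le_succ hi)))
      (toEuclideanLin_lanczosVec_mem A w i)
  exact h hx

/-- A Lanczos vector is a unit vector or zero. -/
theorem inner_self_smul_lanczosVec (j : ℕ) :
    inner ℝ (lanczosVec A w j) (lanczosVec A w j) • lanczosVec A w j = lanczosVec A w j := by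
  have key : ∀ p : EuclideanSpace ℝ (Fin n),
      inner ℝ (‖p‖⁻¹ • p) (‖p‖⁻¹ • p) • (‖p‖⁻¹ • p) = ‖p‖⁻¹ • p := by
    intro p
    rcases eq_or_ne p 0 with rfl | h
    · simp
    · rw [real_inner_self_eq_norm_sq, norm_smul, norm_inv, norm_norm,
        inv_mul_cancel₀ (norm_ne_zero_iff.2 h), one_pow, one_smul]
  rcases j with _ | _ | j <;> rw [lanczosVec] <;> exact key _

theorem inner_self_mul_inner_lanczosVec (j : ℕ) (x : EuclideanSpace ℝ (Fin n)) :
    inner ℝ (lanczosVec A w j) x * inner ℝ (lanczosVec A w j) (lanczosVec A w j)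
      = inner ℝ (lanczosVec A w j) x := by
  conv_rhs => rw [← inner_self_smul_lanczosVec, real_inner_smul_left]
  ring

variable {A}

/-- Only two components are subtracted; symmetry handles the others, because `A v_i` lies in the
span of `v_0, …, v_{i+1}`, already orthogonal to the current vector. Breakdown is covered, as only
`⟨v,v⟩ v = v` is used, not `‖v‖ = 1`. -/
theorem inner_lanczosVec_eq_zero_of_lt (hA : (Matrix.toEuclideanLin A).IsSymmetric) {i j : ℕ}
    (h : i < j) : inner ℝ (lanczosVec A w i) (lanczosVec A w j) = 0 := by
  induction j using Nat.strong_induction_on generalizing i with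
  | _ j ih =>
    rcases j with _ | _ | j
    · omega
    · obtain rfl : i = 0 := by omega
      rw [show lanczosVec A w (0 + 1) = ‖_‖⁻¹ • _ from by rw [lanczosVec], real_inner_smul_right,
        inner_sub_right, real_inner_smul_right, inner_self_mul_inner_lanczosVec, sub_self, mul_zero]
    · rw [show lanczosVec A w (j + 1 + 1) = ‖_‖⁻¹ • _ from by rw [lanczosVec],
        real_inner_smul_right, inner_sub_right, inner_sub_right, real_inner_smul_right,
        real_inner_smul_right]
      have hj := ih (j + 1) (by omega) (i := j) (by omega)
      rcases lt_trichotomy i j with hi | rfl | hi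
      · have h0 : inner ℝ (lanczosVec A w i) (Matrix.toEuclideanLin A (lanczosVec A w (j + 1)))
            = 0 := by
          rw [← hA]
          have hs : lanczosSpan A w (i + 1)
              ≤ LinearMap.ker ((innerₛₗ ℝ).flip (lanczosVec A w (j + 1))) := by
            refine Submodule.span_le.2 ?_
            rintro _ ⟨l, hl, rfl⟩
            have hl : l ≤ i + 1 := hl
            exact ih (j + 1) (by omega) (by omega)
          exact hs (toEuclideanLin_lanczosVec_mem A w i)
        rw [h0, ih j (by omega) hi, ih (j + 1) (by omega) (by omega)]
        simp
      · rw [hj, inner_self_mul_inner_lanczosVec]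
        simp
      · obtain rfl : i = j + 1 := by omega
        rw [inner_self_mul_inner_lanczosVec, real_inner_comm (lanczosVec A w j), hj]
        simp

theorem toEuclideanLin_lanczosV_mul_transpose_apply (m : ℕ) (x : EuclideanSpace ℝ (Fin n)) :
    Matrix.toEuclideanLin (lanczosV A w m * (lanczosV A w m)ᵀ) x
      = ∑ j : Fin m, inner ℝ (lanczosVec A w j) x • lanczosVec A w j := by
  ext i
  rw [Matrix.toLpLin_apply, ← Matrix.mulVec_mulVec]
  simp [Matrix.mulVec, dotProduct, lanczosV, PiLp.inner_apply, mul_comm]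

theorem toEuclideanLin_lanczosV_mul_transpose_of_mem
    (hA : (Matrix.toEuclideanLin A).IsSymmetric) {j m : ℕ} (hj : j < m)
    {x : EuclideanSpace ℝ (Fin n)} (hx : x ∈ lanczosSpan A w j) :
    Matrix.toEuclideanLin (lanczosV A w m * (lanczosV A w m)ᵀ) x = x := by
  have h : lanczosSpan A w j ≤ LinearMap.eqLocus
      (Matrix.toEuclideanLin (lanczosV A w m * (lanczosV A w m)ᵀ)) LinearMap.id := by
    refine Submodule.span_le.2 ?_
    rintro _ ⟨i, hi, rfl⟩
    have hi : i ≤ j := hi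
    change Matrix.toEuclideanLin _ _ = lanczosVec A w i
    rw [toEuclideanLin_lanczosV_mul_transpose_apply, sum_eq_single ⟨i, by omega⟩]
    · exact inner_self_smul_lanczosVec A w i
    · intro l _ hl
      have hl : (l : ℕ) ≠ i := fun h => hl (Fin.ext h)
      rcases lt_or_gt_of_ne hl with h | h
      · rw [inner_lanczosVec_eq_zero_of_lt w hA h, zero_smul]
      · rw [real_inner_comm, inner_lanczosVec_eq_zero_of_lt w hA h, zero_smul]
    · simp
  exact h hx

end Lanczos

/-! ### The differential equation and the series bound -/

section Residual

variable {E : Type*} [NormedAddCommGroup E] [InnerProductSpace ℝ E]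

/-- The derivatives at `0` of the solution of `y'' = -G y + w`, `y(0) = y'(0) = 0`. -/
def odeDeriv (G : E →ₗ[ℝ] E) (w : E) : ℕ → E
  | 0 => 0
  | 1 => 0
  | 2 => w
  | k + 3 => -G (odeDeriv G w (k + 1))

theorem odeDeriv_add_two (G : E →ₗ[ℝ] E) (w : E) (k : ℕ) :
    odeDeriv G w (k + 2) = -G (odeDeriv G w k) + if k = 0 then w else 0 := by
  rcases k with _ | k <;> simp [odeDeriv]

theorem odeDeriv_even (G : E →ₗ[ℝ] E) (w : E) (k : ℕ) :
    odeDeriv G w (2 * k + 2) = (-1 : ℝ) ^ k • (G ^ k) w := by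
  induction k with
  | zero => simp [odeDeriv]
  | succ k ih =>
    rw [odeDeriv_add_two, show 2 * (k + 1) = 2 * k + 2 by ring, ih, if_neg (by omega), pow_succ' G,
      Module.End.mul_apply, map_smul, pow_succ]
    simp

theorem odeDeriv_odd (G : E →ₗ[ℝ] E) (w : E) (k : ℕ) : odeDeriv G w (2 * k + 1) = 0 := by
  induction k with
  | zero => simp [odeDeriv]
  | succ k ih =>
    rw [show 2 * (k + 1) + 1 = 2 * k + 1 + 2 by ring, odeDeriv_add_two, ih]
    simp

theorem norm_odeDeriv_le {G : E →ₗ[ℝ] E} (hG : ∀ x, ‖G x‖ ≤ ‖x‖) (w : E) :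
    ∀ k, ‖odeDeriv G w k‖ ≤ ‖w‖
  | 0 => by simp [odeDeriv]
  | 1 => by simp [odeDeriv]
  | 2 => by simp [odeDeriv]
  | k + 3 => by
    rw [odeDeriv, norm_neg]
    exact (hG _).trans (norm_odeDeriv_le hG w (k + 1))

variable [FiniteDimensional ℝ E]

/-- The power series of `f(G; t) w` solves `y'' = -G y + w`. -/
theorem iteratedDeriv_two_psi_series {G : E →ₗ[ℝ] E} (hG : ∀ x, ‖G x‖ ≤ ‖x‖) {w : E} {y : ℝ → E}
    (hy : ∀ t, HasSum (fun k => (t ^ (2 * k + 2) / ((2 * k + 2).factorial : ℝ))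
      • (-1 : ℝ) ^ k • (G ^ k) w) (y t)) (t : ℝ) :
    iteratedDeriv 2 y t = -G (y t) + w := by
  have _ : CompleteSpace E := FiniteDimensional.complete ℝ E
  have hb := norm_odeDeriv_le hG w
  have hy' : ∀ t, HasSum (fun k => (t ^ k / (k.factorial : ℝ)) • odeDeriv G w k) (y t) := by
    intro t
    have hinj : Function.Injective fun k : ℕ => 2 * k + 2 := fun a b h => by
      simp only at h; omega
    rw [← hinj.hasSum_iff]
    · simpa only [Function.comp_def, odeDeriv_even] using hy t
    · intro k hk
      rcases Nat.even_or_odd' k with ⟨l, rfl | rfl⟩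
      · rcases l with _ | l
        · simp [odeDeriv]
        · exact absurd ⟨l, by ring⟩ hk
      · rw [odeDeriv_odd, smul_zero]
  have e : y = fun t => ∑' k : ℕ, (t ^ k / (k.factorial : ℝ)) • odeDeriv G w k :=
    funext fun t => (hy' t).tsum_eq.symm
  rw [show iteratedDeriv 2 y t = _ from by rw [e, iteratedDeriv_two_tsum hb]]
  refine HasSum.tsum_eq ?_
  have h1 := ((hy' t).mapL (LinearMap.toContinuousLinearMap G)).neg
  have h2 := hasSum_ite_eq (0 : ℕ) w
  convert! h1.add h2 using 2 with k
  rw [odeDeriv_add_two, smul_add]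
  rcases k with _ | k <;> simp

theorem norm_psi_series_le {G R : E →ₗ[ℝ] E} (hGs : G.IsSymmetric)
    (hG : ∀ x, ‖G x‖ ^ 2 ≤ inner ℝ (G x) x) (hR : ∀ x, ‖R x‖ ≤ ‖x‖) {w : E} (hw : ‖w‖ = 1)
    {N : ℕ} (hN : 1 ≤ N) (hRG : ∀ j < N, R ((G ^ j) w) = 0) {t : ℝ} (ht0 : 0 ≤ t) (ht1 : t ≤ 1)
    {y : E} (hy : HasSum (fun k => (t ^ (2 * k + 2) / ((2 * k + 2).factorial : ℝ))
      • (-1 : ℝ) ^ k • (G ^ k) w) y) :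
    ‖R y‖ ≤ 128 / 15 * ((t / 2) ^ (2 * N + 2) / ((2 * N + 2).factorial : ℝ)) := by
  have h := hy.mapL (LinearMap.toContinuousLinearMap R)
  simp only [map_smul, LinearMap.coe_toContinuousLinearMap'] at h
  rw [← hasSum_nat_add_iff' N, sum_eq_zero (fun j hj => by
    rw [hRG j (mem_range.1 hj), smul_zero, smul_zero]), sub_zero] at h
  -- The tail bound contributes `2`, and `t^(2N+2) / 4^N = 4 (t/2)^(2N+2)`.
  set C : ℝ := 8 * ((t / 2) ^ (2 * N + 2) / ((2 * N + 2).factorial : ℝ)) with hC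
  have hgeom := (hasSum_geometric_of_lt_one (r := (1 / 16 : ℝ)) (by norm_num) (by norm_num)).mul_left C
  have hle := h.norm_le_of_bounded hgeom fun j => ?_
  · convert hle using 1
    rw [hC]
    norm_num
    ring
  · have h1 := norm_apply_pow_le hGs hG hR hw hRG (j + N)
    have h2 := four_pow_mul_sum_choose_le N j hN
    rw [show j + N + 1 - N = j + 1 by omega] at h1
    rw [norm_smul, norm_smul, norm_pow, norm_neg, norm_one, one_pow, one_mul, norm_div, norm_pow,
      RCLike.norm_natCast, Real.norm_of_nonneg ht0]
    rw [add_comm j N] at h1 ⊢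
    set D := ∑ i ∈ range (j + 1), (2 * (N + j)).choose i with hD
    have h1' : ‖R ((G ^ (N + j)) w)‖ ≤ 2 / 4 ^ (N + j) * D := by
      rw [hD]; push_cast; exact h1
    have h2' : (4 : ℝ) ^ j * D * ((2 * N + 2).factorial : ℝ) ≤ ((2 * (N + j) + 2).factorial : ℝ) := by
      exact_mod_cast h2
    have ht : t ^ (2 * (N + j) + 2) ≤ t ^ (2 * N + 2) :=
      pow_le_pow_of_le_one ht0 ht1 (by omega)
    calc _ ≤ t ^ (2 * N + 2) / ((2 * (N + j) + 2).factorial : ℝ) * (2 / 4 ^ (N + j) * D) := by gcongr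
      _ = t ^ (2 * N + 2) * 2 / 4 ^ (N + j) * (D / ((2 * (N + j) + 2).factorial : ℝ)) := by ring
      _ ≤ t ^ (2 * N + 2) * 2 / 4 ^ (N + j) * (1 / (4 ^ j * ((2 * N + 2).factorial : ℝ))) := by
        refine mul_le_mul_of_nonneg_left ?_ (by positivity)
        rw [div_le_div_iff₀ (by positivity) (by positivity)]
        linarith
      _ = C * (1 / 16) ^ j := by
        have e4 : (4 : ℝ) ^ N = 2 ^ (2 * N) := by rw [pow_mul]; norm_num
        have e16 : (16 : ℝ) ^ j = 4 ^ j * 4 ^ j := by rw [← mul_pow]; norm_num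
        rw [hC, div_pow, one_div_pow, e16, pow_add 4, e4, pow_add 2]
        field_simp
        norm_num

end Residual

/-! ### The approximation as a function of `P A P` -/

section Compression

theorem apply_comp_pow_apply {E : Type*} [AddCommGroup E] [Module ℝ E] {P a : E →ₗ[ℝ] E} {w : E}
    (hPP : ∀ x, P (P x) = P x) (hPw : P w = w) (k : ℕ) :
    P (((P ∘ₗ a ∘ₗ P) ^ k) w) = ((P ∘ₗ a ∘ₗ P) ^ k) w := by
  rcases k with _ | k
  · simpa using hPw
  · rw [pow_succ', Module.End.mul_apply, LinearMap.comp_apply, hPP]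

variable {n m : ℕ} {A : Matrix (Fin n) (Fin n) ℝ} {w : EuclideanSpace ℝ (Fin n)}
  {P : EuclideanSpace ℝ (Fin n) →ₗ[ℝ] EuclideanSpace ℝ (Fin n)}

/-- Regrouping the products produces only `V Vᵀ`; the relation `Vᵀ V = 1`, false after a breakdown,
is never needed. -/
theorem toEuclideanLin_lanczosH_pow_apply
    (hP : Matrix.toEuclideanLin (lanczosV A w m * (lanczosV A w m)ᵀ) = P)
    (hPP : ∀ x, P (P x) = P x) (hPw : P w = w) (k : ℕ) :
    Matrix.toEuclideanLin (lanczosV A w m * lanczosH A w m ^ k * (lanczosV A w m)ᵀ) w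
      = ((P ∘ₗ Matrix.toEuclideanLin A ∘ₗ P) ^ k) w := by
  induction k with
  | zero => rw [pow_zero, Matrix.mul_one, hP, hPw, pow_zero, Module.End.one_apply]
  | succ k ih =>
    have e : lanczosV A w m * lanczosH A w m ^ (k + 1) * (lanczosV A w m)ᵀ
        = (lanczosV A w m * (lanczosV A w m)ᵀ)
          * (A * (lanczosV A w m * lanczosH A w m ^ k * (lanczosV A w m)ᵀ)) := by
      rw [pow_succ']
      generalize lanczosH A w m ^ k = F
      rw [lanczosH]
      simp only [Matrix.mul_assoc]
    rw [e, Matrix.toLpLin_mul_same _ (lanczosV A w m * _), Matrix.toLpLin_mul_same _ A, hP, LinearMap.comp_apply,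
      LinearMap.comp_apply, ih, pow_succ', Module.End.mul_apply, LinearMap.comp_apply,
      LinearMap.comp_apply, apply_comp_pow_apply hPP hPw]

/-- The Lanczos approximation as a power series in the compression `P A P`, `P = V_m V_mᵀ`. -/
theorem hasSum_lanczosApprox
    (hP : Matrix.toEuclideanLin (lanczosV A w m * (lanczosV A w m)ᵀ) = P)
    (hPP : ∀ x, P (P x) = P x) (hPw : P w = w) (t : ℝ) :
    HasSum (fun k => (t ^ (2 * k + 2) / ((2 * k + 2).factorial : ℝ)) • (-1 : ℝ) ^ k
      • ((P ∘ₗ Matrix.toEuclideanLin A ∘ₗ P) ^ k) w) (lanczosApprox A w m t) := by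
  let L : Matrix (Fin m) (Fin m) ℝ →ₗ[ℝ] EuclideanSpace ℝ (Fin n) :=
    { toFun := fun F => Matrix.toEuclideanLin (lanczosV A w m * F * (lanczosV A w m)ᵀ) w
      map_add' := fun F G => by simp [Matrix.mul_add, Matrix.add_mul]
      map_smul' := fun c F => by simp }
  have hL : ∀ k, L (lanczosH A w m ^ k) = ((P ∘ₗ Matrix.toEuclideanLin A ∘ₗ P) ^ k) w :=
    toEuclideanLin_lanczosH_pow_apply hP hPP hPw
  have h := ((hasSum_psi_matrix (t ^ 2 • lanczosH A w m)).const_smul (t ^ 2 / 2)).map L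
    (LinearMap.continuous_of_finiteDimensional L)
  have hy : lanczosApprox A w m t = L ((t ^ 2 / 2) • psi (t ^ 2 • lanczosH A w m)) := rfl
  rw [hy]
  refine h.congr_fun ?_
  intro k
  rw [Function.comp_apply, _root_.smul_pow, map_smul, map_smul, map_smul, hL, smul_smul, smul_smul,
    smul_smul]
  congr 1
  rw [psiCoeff]
  ring

end Compression

end

end LanczosPsi

/-! ### The residual bound -/

theorem proposition3p6 (n : ℕ) (A : Matrix (Fin n) (Fin n) ℝ) (hA : A.IsSymm)
    (hspec : spectrum ℝ A ⊆ Set.Icc 0 1) (w : EuclideanSpace ℝ (Fin n)) (hw : ‖w‖ = 1)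
    (m : ℕ) (hm : 2 ≤ m) (t : ℝ) (ht0 : 0 ≤ t) (ht1 : t ≤ 1) :
    ‖LanczosPsi.lanczosResidual A w m t‖ ≤
      128 / 15 * ((t / 2) ^ (2 * m) / ((2 * m).factorial : ℝ)) := by
  open LanczosPsi in
  have ha : (Matrix.toEuclideanLin A).IsSymmetric := by
    rw [Matrix.isSymmetric_toEuclideanLin_iff, Matrix.IsHermitian,
      Matrix.conjTranspose_eq_transpose_of_trivial]
    exact hA
  have hasq := norm_sq_apply_le_inner ha (inner_toEuclideanLin_bounds hA hspec)
  have hPmem : ∀ {j x}, j < m → x ∈ lanczosSpan A w j →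
      Matrix.toEuclideanLin (lanczosV A w m * (lanczosV A w m)ᵀ) x = x :=
    fun hj hx => toEuclideanLin_lanczosV_mul_transpose_of_mem w ha hj hx
  have hPapp := toEuclideanLin_lanczosV_mul_transpose_apply (A := A) w m
  have hPs : (Matrix.toEuclideanLin (lanczosV A w m * (lanczosV A w m)ᵀ)).IsSymmetric := by
    rw [Matrix.isSymmetric_toEuclideanLin_iff, Matrix.IsHermitian,
      Matrix.conjTranspose_eq_transpose_of_trivial, Matrix.transpose_mul,
      Matrix.transpose_transpose]
  have hmem : ∀ k, ∀ j ≤ k, lanczosVec A w j ∈ lanczosSpan A w k :=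
    fun k j hj => lanczosVec_mem_lanczosSpan A w hj
  generalize hP : Matrix.toEuclideanLin (lanczosV A w m * (lanczosV A w m)ᵀ) = P at *
  set a := Matrix.toEuclideanLin A with ha_def
  have hPP : ∀ x, P (P x) = P x := fun x => by
    refine hPmem (j := m - 1) (by omega) ?_
    rw [hPapp]
    exact sum_mem fun j _ => Submodule.smul_mem _ _ (hmem _ _ (by omega))
  have hPsq : ∀ x, ‖P x‖ ^ 2 = inner ℝ (P x) x := fun x => by
    rw [← real_inner_self_eq_norm_sq, ← hPs, hPP]
  have hPnorm : ∀ x, ‖P x‖ ^ 2 + ‖x - P x‖ ^ 2 = ‖x‖ ^ 2 := fun x => by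
    rw [norm_sub_sq_real, real_inner_comm, ← hPsq]
    ring
  set G := P ∘ₗ a ∘ₗ P with hG
  have hGs : G.IsSymmetric := fun x y => by
    simp only [hG, LinearMap.comp_apply]
    rw [hPs, ha, hPs]
  -- `‖P A P x‖² ≤ ‖A P x‖² ≤ ⟨A P x, P x⟩`: compression preserves the form inequality.
  have hGsq : ∀ x, ‖G x‖ ^ 2 ≤ inner ℝ (G x) x := fun x => by
    simp only [hG, LinearMap.comp_apply]
    rw [hPs]
    nlinarith [hPnorm (a (P x)), hasq (P x), sq_nonneg ‖a (P x) - P (a (P x))‖]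
  have hle_of_sq : ∀ {b : EuclideanSpace ℝ (Fin n) →ₗ[ℝ] EuclideanSpace ℝ (Fin n)},
      (∀ x, ‖b x‖ ^ 2 ≤ inner ℝ (b x) x) → ∀ x, ‖b x‖ ≤ ‖x‖ := fun {b} hb x => by
    have h1 := hb x
    have h2 := real_inner_le_norm (b x) x
    rcases (norm_nonneg (b x)).eq_or_lt with h | h
    · rw [← h]; exact norm_nonneg _
    · exact le_of_mul_le_mul_left (by nlinarith) h
  set R := a - P ∘ₗ a with hR_def
  have hR : ∀ x, ‖R x‖ ≤ ‖x‖ := fun x => by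
    refine le_trans ?_ (hle_of_sq hasq x)
    refine le_of_sq_le_sq ?_ (norm_nonneg _)
    simp only [hR_def, LinearMap.sub_apply, LinearMap.comp_apply]
    nlinarith [hPnorm (a x), sq_nonneg ‖P (a x)‖]
  have hKrylov : ∀ j < m, (G ^ j) w ∈ lanczosSpan A w j := fun j => by
    induction j with
    | zero => exact fun _ => mem_lanczosSpan_zero A w hw
    | succ j ih =>
      intro hj
      have h1 := ih (by omega)
      have h2 := toEuclideanLin_mem_lanczosSpan_succ A w h1
      have e : (G ^ (j + 1)) w = a ((G ^ j) w) := by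
        rw [pow_succ', Module.End.mul_apply]
        conv_lhs => rw [hG]
        rw [LinearMap.comp_apply, LinearMap.comp_apply, ← hG, hPmem (by omega) h1, hPmem hj h2]
      rw [e]
      exact h2
  -- `A` raises the Krylov index by one, so `j + 1 < m` is required for `P` to fix the image.
  have hRG : ∀ j < m - 1, R ((G ^ j) w) = 0 := fun j hj => by
    have h2 := toEuclideanLin_mem_lanczosSpan_succ A w (hKrylov j (by omega))
    simp only [hR_def, LinearMap.sub_apply, LinearMap.comp_apply]
    rw [hPmem (by omega) h2, sub_self]
  have hPw : P w = w := hPmem (by omega) (mem_lanczosSpan_zero A w hw)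
  have hy := hasSum_lanczosApprox hP hPP hPw
  have hPy : P (lanczosApprox A w m t) = lanczosApprox A w m t := by
    have h := (hy t).mapL (LinearMap.toContinuousLinearMap P)
    simp only [map_smul, LinearMap.coe_toContinuousLinearMap', apply_comp_pow_apply hPP hPw] at h
    exact h.unique (hy t)
  have hres : lanczosResidual A w m t = -R (lanczosApprox A w m t) := by
    rw [lanczosResidual, iteratedDeriv_two_psi_series (hle_of_sq hGsq) hy]
    simp only [hG, hR_def, LinearMap.sub_apply, LinearMap.comp_apply, hPy]
    abel
  rw [hres, norm_neg]
  have h := norm_psi_series_le hGs hGsq hR hw (by omega) hRG ht0 ht1 (hy t)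
  rwa [show 2 * (m - 1) + 2 = 2 * m by omega] at h
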